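/- Let $n,m\in\mathbb N$ and let $\varphi:\mathbb R^n\times\mathbb R^m\to\mathbb R$, $z=(x,y)\mapsto\varphi(x,y)$, be twice continuously differentiable. Suppose that $\varphi$ is $\sigma$-convex-concave for some $\sigma\in\mathbb R$, i.e. $\nabla^2_{xx}\varphi(z)\succeq\sigma I$ and $-\nabla^2_{yy}\varphi(z)\succeq\sigma I$ for all $z\in\mathbb R^{n+m}$, where $\succeq$ is the Loewner order. Let $\delta\in(0,1/[-\sigma]_+)$, where $[-\sigma]_+=\max\{0,-\sigma\}$ and $1/0=\infty$, let $\alpha>-1/\delta$, and suppose that the $\alpha$-interaction dominance condition with parameter $\delta$ holds: for all $z\in\mathbb R^{n+m}$, $$\nabla_{xx}^{2}\varphi(z)+\nabla_{xy}^{2}\varphi(z)\left(\tfrac1{\delta}I-\nabla_{yy}^{2}\varphi(z)\right)^{-1}\nabla_{yx}^{2}\varphi(z)\succeq\alpha I,$$ $$-\nabla_{yy}^{2}\varphi(z)+\nabla_{yx}^{2}\varphi(z)\left(\tfrac1{\delta}I+\nabla_{xx}^{2}\varphi(z)\right)^{-1}\nabla_{xy}^{2}\varphi(z)\succeq\alpha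 I.$$ An operator $A:\mathbb R^N\rightrightarrows\mathbb R^N$ is called $(\mu,\rho)$-semimonotone, for $\mu,\rho\in\mathbb R$, if $\langle u-u',v-v'\rangle\ge\mu\|u-u'\|^2+\rho\|v-v'\|^2$ for all $(u,v),(u',v')$ in the graph of $A$. Then the following hold for the saddle operator $T_\varphi(z)=(\nabla_x\varphi(z),-\nabla_y\varphi(z))$ on $\mathbb R^{n+m}$. 1. If $\alpha<1/\delta$, then $T_\varphi$ is $\left(\frac{\alpha}{1-\alpha\delta},-\frac{\delta}{1-\alpha\delta}\right)$-semimonotone. 2. If $\alpha\ge0$, then $T_\varphi$ is $(0,-\delta)$-semimonotone. -/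

import Mathlib

open scoped Gradient RealInnerProductSpace

noncomputable section

section Operators

variable {H : Type*} [NormedAddCommGroup H] [InnerProductSpace ℝ H]

/-- A set-valued operator `A : H ⇉ H` is `(μ, ρ)`-semimonotone at `(x', y')` if `y' ∈ A x'` and
`⟪x - x', y - y'⟫ ≥ μ ‖x - x'‖² + ρ ‖y - y'‖²` for all `(x, y)` in the graph of `A`. -/
def IsSemimonotoneAt (A : H → Set H) (μ ρ : ℝ) (x' y' : H) : Prop :=
  y' ∈ A x' ∧ ∀ x y : H, y ∈ A x →
    μ * ‖x - x'‖ ^ 2 + ρ * ‖y - y'‖ ^ 2 ≤ ⟪x - x', y - y'⟫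

/-- A set-valued operator is `(μ, ρ)`-semimonotone if it is so at every point of its graph. -/
def IsSemimonotone (A : H → Set H) (μ ρ : ℝ) : Prop :=
  ∀ x' y' : H, y' ∈ A x' → IsSemimonotoneAt A μ ρ x' y'

end Operators

section Saddle

variable {X Y : Type*} [NormedAddCommGroup X] [InnerProductSpace ℝ X] [CompleteSpace X]
  [NormedAddCommGroup Y] [InnerProductSpace ℝ Y] [CompleteSpace Y]

/-- The partial gradient `∇ₓ φ(x, y) ∈ X`. -/
def gradX (φ : X → Y → ℝ) (x : X) (y : Y) : X :=
  ∇ (fun x' => φ x' y) x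

/-- The partial gradient `∇_y φ(x, y) ∈ Y`. -/
def gradY (φ : X → Y → ℝ) (x : X) (y : Y) : Y :=
  ∇ (fun y' => φ x y') y

/-- The Hessian block `∇²ₓₓ φ(x, y)`, as a linear map on `X`. -/
def hessXX (φ : X → Y → ℝ) (x : X) (y : Y) : X →L[ℝ] X :=
  fderiv ℝ (fun x' => gradX φ x' y) x

/-- The Hessian block `∇²_xy φ(x, y)` (an `n × m` matrix if `X = ℝⁿ`, `Y = ℝᵐ`),
as a linear map `Y → X`. -/
def hessXY (φ : X → Y → ℝ) (x : X) (y : Y) : Y →L[ℝ] X :=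
  fderiv ℝ (fun y' => gradX φ x y') y

/-- The Hessian block `∇²_yx φ(x, y)` (an `m × n` matrix if `X = ℝⁿ`, `Y = ℝᵐ`),
as a linear map `X → Y`. -/
def hessYX (φ : X → Y → ℝ) (x : X) (y : Y) : X →L[ℝ] Y :=
  fderiv ℝ (fun x' => gradY φ x' y) x

/-- The Hessian block `∇²_yy φ(x, y)`, as a linear map on `Y`. -/
def hessYY (φ : X → Y → ℝ) (x : X) (y : Y) : Y →L[ℝ] Y :=
  fderiv ℝ (fun y' => gradY φ x y') y

/-- `φ` is `σ`-convex-concave: `∇²ₓₓ φ ⪰ σ I` and `-∇²_yy φ ⪰ σ I` everywhere.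
The order `≤` on continuous linear maps is the Loewner order, and `1` is the identity. -/
def IsConvexConcave (φ : X → Y → ℝ) (σ : ℝ) : Prop :=
  ∀ x y, σ • 1 ≤ hessXX φ x y ∧ σ • 1 ≤ -hessYY φ x y

/-- The `α`-interaction dominance condition with parameter `δ`. Under `σ`-convex-concavity and
`0 < δ < 1 / max 0 (-σ)`, the operators that are inverted here are positive definite, so that
`ContinuousLinearMap.inverse` is the inverse. -/
def IsInteractionDominant (φ : X → Y → ℝ) (α δ : ℝ) : Prop :=
  ∀ x y,
    α • 1 ≤ hessXX φ x y +
      hessXY φ x y ∘L ((1 / δ) • 1 - hessYY φ x y).inverse ∘L hessYX φ x y ∧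
    α • 1 ≤ -hessYY φ x y +
      hessYX φ x y ∘L ((1 / δ) • 1 + hessXX φ x y).inverse ∘L hessXY φ x y

/-- The saddle operator `z = (x, y) ↦ (∇ₓ φ(z), -∇_y φ(z))` on `X × Y` with its Euclidean (`ℓ²`) inner
product, seen as a (single-valued) set-valued operator. -/
def saddleOp (φ : X → Y → ℝ) :
    WithLp 2 (X × Y) → Set (WithLp 2 (X × Y)) :=
  fun z => {WithLp.toLp 2 (gradX φ z.fst z.snd, -gradY φ z.fst z.snd)}

end Saddle

end

/-! Put `F = id + δ T_φ` and `β = 1 + αδ`. Both claims follow by expanding squares in `β ⟪F z - F w,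
z - w⟫ ≤ ‖F z - F w‖²`. This bound is not integrated along `[w, z]`, since its pointwise form is
quadratic in `F'` on the right. Convex-concavity and `1 + δσ > 0` make `F'` uniformly coercive, so
`F` is a bijection; for `G = F⁻¹` the bound becomes `⟪G' q, q⟫ ≤ β⁻¹ ‖q‖²`, linear in `G'`, and
integrates along segments in the image (`mul_inner_sub_le_of_fderiv`). Pointwise, `F' = δ K` with
`K` a block operator whose off-diagonal blocks are skew-adjoint to each other. In the quadratic form
of `K⁻¹` the off-diagonal terms cancel, leaving the inverse Schur complements, which interaction
dominance controls (`mul_inner_block_le_of_schur_ge`). -/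

open scoped Gradient RealInnerProductSpace

/-! ### Strongly monotone maps and their inverses. -/

section StronglyMonotone

variable {E : Type*} [NormedAddCommGroup E] [InnerProductSpace ℝ E]

/-- A lower bound on the quadratic form of the derivative integrates to strong monotonicity. -/
lemma inner_sub_ge_of_inner_fderiv_ge {f : E → E} {f' : E → E →L[ℝ] E} {c : ℝ}
    (hf : ∀ z, HasFDerivAt f (f' z) z) (hc : ∀ z q, c * ‖q‖ ^ 2 ≤ ⟪f' z q, q⟫) (z w : E) :
    c * ‖z - w‖ ^ 2 ≤ ⟪f z - f w, z - w⟫ := by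
  have hg : ∀ t : ℝ, HasDerivAt (fun t : ℝ => ⟪f (w + t • (z - w)), z - w⟫)
      ⟪f' (w + t • (z - w)) (z - w), z - w⟫ t := by
    intro t
    have h1 : HasDerivAt (fun t : ℝ => w + t • (z - w)) (z - w) t := by
      simpa using ((hasDerivAt_id t).smul_const (z - w)).const_add w
    have h2 := (hf (w + t • (z - w))).comp_hasDerivAt t h1
    simpa using h2.inner ℝ (hasDerivAt_const t (z - w))
  have h := mul_sub_le_image_sub_of_le_deriv (C := c * ‖z - w‖ ^ 2)
    (fun t => (hg t).differentiableAt)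
    (fun t => by rw [(hg t).deriv]; exact hc _ _) (zero_le_one (α := ℝ))
  simpa [inner_sub_left] using h

lemma antilipschitzWith_of_inner_sub_ge {f : E → E} {c : ℝ} (hc : 0 < c)
    (hf : ∀ z w, c * ‖z - w‖ ^ 2 ≤ ⟪f z - f w, z - w⟫) :
    AntilipschitzWith (Real.toNNReal c⁻¹) f := by
  refine AntilipschitzWith.of_le_mul_dist fun z w => ?_
  rw [Real.coe_toNNReal _ (inv_nonneg.2 hc.le), dist_eq_norm, dist_eq_norm,
    inv_mul_eq_div, le_div_iff₀ hc]
  rcases (norm_nonneg (z - w)).eq_or_lt with h | h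
  · rw [← h, zero_mul]
    exact norm_nonneg _
  · have h1 := (hf z w).trans (real_inner_le_norm _ _)
    nlinarith

/-- A continuous antilipschitz map on a complete space has closed range. -/
lemma isClosed_range_of_antilipschitzWith {E : Type*} [MetricSpace E] [CompleteSpace E] {f : E → E} {K : NNReal}
    (hf : AntilipschitzWith K f) (hcont : Continuous f) : IsClosed (Set.range f) := by
  refine isClosed_of_closure_subset fun y hy => ?_
  obtain ⟨u, hu, huy⟩ := mem_closure_iff_seq_limit.1 hy
  choose x hx using hu
  have hx' : f ∘ x = u := funext hx
  have hcau : CauchySeq x := by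
    have h := huy.cauchySeq
    rw [Metric.cauchySeq_iff] at h ⊢
    intro ε hε
    obtain ⟨N, hN⟩ := h (ε / (K + 1)) (by positivity)
    refine ⟨N, fun i hi j hj => ?_⟩
    have h1 := hf.le_mul_dist (x i) (x j)
    rw [hx, hx] at h1
    have h2 := hN i hi j hj
    rw [lt_div_iff₀ (by positivity)] at h2
    nlinarith [dist_nonneg (x := u i) (y := u j)]
  obtain ⟨a, ha⟩ := cauchySeq_tendsto_of_complete hcau
  have h3 := (hcont.tendsto a).comp ha
  rw [hx'] at h3
  exact ⟨a, tendsto_nhds_unique h3 huy⟩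

lemma bijective_of_inner_ge [CompleteSpace E] (T : E →L[ℝ] E) {c : ℝ} (hc : 0 < c)
    (h : ∀ q, c * ‖q‖ ^ 2 ≤ ⟪T q, q⟫) : Function.Bijective T :=
  ContinuousLinearMap.isUnit_iff_bijective.1 <|
    T.isUnit_of_forall_le_norm_inner_map (c := ⟨c, hc.le⟩) hc fun q => by
      rw [mul_comm]
      exact (h q).trans (le_abs_self _)

lemma exists_equiv_of_inner_ge [CompleteSpace E] (T : E →L[ℝ] E) {c : ℝ} (hc : 0 < c)
    (h : ∀ q, c * ‖q‖ ^ 2 ≤ ⟪T q, q⟫) : ∃ e : E ≃L[ℝ] E, (e : E →L[ℝ] E) = T := by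
  have hb := bijective_of_inner_ge T hc h
  exact ⟨ContinuousLinearEquiv.ofBijective T (LinearMap.ker_eq_bot.2 hb.1)
    (LinearMap.range_eq_top.2 hb.2), ContinuousLinearEquiv.coe_ofBijective _ _ _⟩

lemma apply_inverse_of_inner_ge [CompleteSpace E] (T : E →L[ℝ] E) {c : ℝ} (hc : 0 < c)
    (h : ∀ q, c * ‖q‖ ^ 2 ≤ ⟪T q, q⟫) (x : E) : T (T.inverse x) = x := by
  obtain ⟨e, rfl⟩ := exists_equiv_of_inner_ge T hc h
  simp

/-- If the derivative of `F` is uniformly coercive and its inverse is pointwise `β`-cocoercive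
in the sense `β ⟪F' q, q⟫ ≤ ‖F' q‖²`, then the same inequality holds for the increments of `F`. -/
lemma mul_inner_sub_le_of_fderiv [CompleteSpace E] {F : E → E} {F' : E → E →L[ℝ] E} {c β : ℝ}
    (hβ : 0 < β) (hc : 0 < c) (hF : ∀ z, HasStrictFDerivAt F (F' z) z)
    (hF' : ∀ z q, c * ‖q‖ ^ 2 ≤ ⟪F' z q, q⟫)
    (hβF : ∀ z q, β * ⟪F' z q, q⟫ ≤ ‖F' z q‖ ^ 2) (z w : E) :
    β * ⟪F z - F w, z - w⟫ ≤ ‖F z - F w‖ ^ 2 := by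
  choose e he using fun z => exists_equiv_of_inner_ge (F' z) hc (hF' z)
  have hanti := antilipschitzWith_of_inner_sub_ge hc
    (inner_sub_ge_of_inner_fderiv_ge (fun z => (hF z).hasFDerivAt) hF')
  have hcont : Continuous F := continuous_iff_continuousAt.2 fun z => (hF z).continuousAt
  have hopen : IsOpenMap F := isOpenMap_of_hasStrictFDerivAt_equiv (f' := e)
    fun z => by rw [he]; exact hF z
  -- The range is closed, open and nonempty in a connected space.
  have hsurj : Function.Surjective F := Set.range_eq_univ.1 <|
    IsClopen.eq_univ ⟨isClosed_range_of_antilipschitzWith hanti hcont, hopen.isOpen_range⟩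
      (Set.range_nonempty F)
  have hright := Function.rightInverse_surjInv hsurj
  set G := Function.surjInv hsurj
  have hGcont : Continuous G := (hanti.to_rightInverse hright).continuous
  -- The sign turns the upper bound on `G'` into the lower bound that integrates.
  have hG : ∀ p, HasFDerivAt (fun p => -G p) (-((e (G p)).symm : E →L[ℝ] E)) p := fun p =>
    (HasFDerivAt.of_local_left_inverse hGcont.continuousAt
      (by rw [he]; exact (hF _).hasFDerivAt) (Filter.Eventually.of_forall hright)).neg
  have hmon := inner_sub_ge_of_inner_fderiv_ge (c := -β⁻¹) hG (fun p q => by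
    have h := hβF (G p) ((e (G p)).symm q)
    rw [← he] at h
    simp only [ContinuousLinearEquiv.coe_coe, ContinuousLinearEquiv.apply_symm_apply] at h
    simp only [neg_apply, ContinuousLinearEquiv.coe_coe, inner_neg_left, neg_mul, neg_le_neg_iff]
    rw [real_inner_comm, inv_mul_eq_div, le_div_iff₀ hβ, mul_comm]
    exact h) (F z) (F w)
  have hleft : ∀ z, G (F z) = z := fun z => hanti.injective (hright (F z))
  simp only [hleft] at hmon
  rw [neg_sub_neg, ← neg_sub z w, inner_neg_left, neg_mul, neg_le_neg_iff, inv_mul_eq_div,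
    le_div_iff₀ hβ, real_inner_comm, mul_comm] at hmon
  exact hmon

end StronglyMonotone

/-! ### Schur complements and the Loewner order. -/

section SchurComplement

/-- Cauchy-Schwarz gives `γ ‖s‖ ≤ ‖u‖`; a second use of it gives the bound. -/
lemma mul_inner_le_norm_sq_of_inner_ge {E : Type*} [NormedAddCommGroup E] [InnerProductSpace ℝ E]
    {γ : ℝ} (hγ : 0 < γ) {u s : E} (h : γ * ‖s‖ ^ 2 ≤ ⟪u, s⟫) : γ * ⟪u, s⟫ ≤ ‖u‖ ^ 2 := by
  have h1 : 0 ≤ ‖u - γ • s‖ ^ 2 := sq_nonneg _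
  have h2 := real_inner_le_norm u s
  rcases (norm_nonneg s).eq_or_lt with h0 | h0
  · rw [norm_eq_zero.1 h0.symm, inner_zero_right, mul_zero]
    positivity
  · have h3 : γ * ‖s‖ ≤ ‖u‖ := by nlinarith
    nlinarith [norm_nonneg u]

variable {X Y : Type*} [NormedAddCommGroup X] [InnerProductSpace ℝ X] [CompleteSpace X]
  [NormedAddCommGroup Y] [InnerProductSpace ℝ Y] [CompleteSpace Y]

/-- If both Schur complements of the block operator `K = [[P, B], [-B*, R]]` are bounded below
by `γ > 0`, then `γ ⟪K q, q⟫ ≤ ‖K q‖²`. -/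
lemma mul_inner_block_le_of_schur_ge {P : X →L[ℝ] X} {R : Y →L[ℝ] Y} {B : Y →L[ℝ] X}
    {C : X →L[ℝ] Y} {c γ : ℝ} (hc : 0 < c) (hγ : 0 < γ)
    (hBC : ∀ k h, ⟪B k, h⟫ = ⟪k, C h⟫)
    (hPs : ∀ x x', ⟪P x, x'⟫ = ⟪x, P x'⟫) (hRs : ∀ y y', ⟪R y, y'⟫ = ⟪y, R y'⟫)
    (hP : ∀ x, c * ‖x‖ ^ 2 ≤ ⟪P x, x⟫) (hR : ∀ y, c * ‖y‖ ^ 2 ≤ ⟪R y, y⟫)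
    (hX : ∀ x, γ * ‖x‖ ^ 2 ≤ ⟪P x + B (R.inverse (C x)), x⟫)
    (hY : ∀ y, γ * ‖y‖ ^ 2 ≤ ⟪R y + C (P.inverse (B y)), y⟫) (a : X) (b : Y) :
    γ * (⟪P a + B b, a⟫ + ⟪R b - C a, b⟫) ≤ ‖P a + B b‖ ^ 2 + ‖R b - C a‖ ^ 2 := by
  -- `s` and `t` are the inverse Schur complements applied to the two components of `K (a, b)`.
  obtain ⟨s, hs⟩ := (bijective_of_inner_ge (P + B ∘L R.inverse ∘L C) hγ hX).2 (P a + B b)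
  obtain ⟨t, ht⟩ := (bijective_of_inner_ge (R + C ∘L P.inverse ∘L B) hγ hY).2 (R b - C a)
  have hsx : P s + B (R.inverse (C s)) = P a + B b := hs
  have hty : R t + C (P.inverse (B t)) = R b - C a := ht
  have hPi := apply_inverse_of_inner_ge P hc hP
  have hRi := apply_inverse_of_inner_ge R hc hR
  set p := P.inverse (B t) with hp
  set r := R.inverse (C s) with hr
  have hPp : P p = B t := hPi _
  have hRr : R r = C s := hRi _
  -- `(s - p, t + r)` solves the same block system as `(a, b)`
  have key : ∀ (d : X) (f : Y), P d + B f = 0 → R f - C d = 0 → d = 0 ∧ f = 0 := by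
    intro d f h1 h2
    -- Pairing with `(d, f)` cancels the mixed terms, so coercivity of `P` and `R` forces both to
    -- vanish.
    have h3 : ⟪P d + B f, d⟫ + ⟪R f - C d, f⟫ = 0 := by simp [h1, h2]
    rw [inner_add_left, inner_sub_left, hBC, real_inner_comm f (C d)] at h3
    have h4 := hP d
    have h5 := hR f
    have h6 : 0 ≤ c * ‖d‖ ^ 2 := by positivity
    have h7 : 0 ≤ c * ‖f‖ ^ 2 := by positivity
    have h8 : c * ‖d‖ ^ 2 = 0 := by linarith
    have h9 : c * ‖f‖ ^ 2 = 0 := by linarith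
    simpa [hc.ne'] using And.intro h8 h9
  obtain ⟨h1, h2⟩ := key (a - (s - p)) (b - (t + r))
    (by
      simp only [map_sub, map_add, hPp]
      rw [← sub_eq_zero.2 hsx.symm]; abel)
    (by
      simp only [map_sub, map_add, hRr]
      rw [← sub_eq_zero.2 hty.symm]; abel)
  have ha : a = s - p := sub_eq_zero.1 h1
  have hb : b = t + r := sub_eq_zero.1 h2
  -- The two cross terms are equal and enter `h3` with opposite signs.
  have e1 : ⟪P s + B r, p⟫ = ⟪s, B t⟫ + ⟪r, C p⟫ := by
    rw [inner_add_left, hPs, hPp, hBC]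
  have e2 : ⟪R t + C p, r⟫ = ⟪s, B t⟫ + ⟪r, C p⟫ := by
    rw [inner_add_left, hRs, hRr, ← hBC, real_inner_comm, real_inner_comm r]
  have h3 : ⟪P a + B b, a⟫ + ⟪R b - C a, b⟫ = ⟪P s + B r, s⟫ + ⟪R t + C p, t⟫ := by
    rw [← hsx, ← hty, ha, hb, inner_sub_right, inner_add_right, e1, e2]
    ring
  rw [h3, ← hsx, ← hty, mul_add]
  exact add_le_add (mul_inner_le_norm_sq_of_inner_ge hγ (hX s))
    (mul_inner_le_norm_sq_of_inner_ge hγ (hY t))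

lemma inner_ge_of_smul_one_le {X : Type*} [NormedAddCommGroup X] [InnerProductSpace ℝ X]
    {A : X →L[ℝ] X} {c : ℝ} (h : c • (1 : X →L[ℝ] X) ≤ A) (x : X) :
    c * ‖x‖ ^ 2 ≤ ⟪A x, x⟫ := by
  have h1 := ((ContinuousLinearMap.le_def _ _).1 h).inner_nonneg_left x
  simp only [sub_apply, smul_apply, one_apply_eq_self, inner_sub_left,
    real_inner_smul_left, real_inner_self_eq_norm_sq] at h1
  linarith

lemma inner_symm_of_smul_one_le {X : Type*} [NormedAddCommGroup X] [InnerProductSpace ℝ X]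
    {A : X →L[ℝ] X} {c : ℝ} (h : c • (1 : X →L[ℝ] X) ≤ A) (x y : X) :
    ⟪A x, y⟫ = ⟪x, A y⟫ := by
  have h1 := ((ContinuousLinearMap.le_def _ _).1 h).isSymmetric x y
  simp only [ContinuousLinearMap.coe_coe, sub_apply, smul_apply,
    one_apply_eq_self, inner_sub_left, inner_sub_right, real_inner_smul_left,
    real_inner_smul_right] at h1
  linarith

lemma smul_one_add_le_of_smul_one_le {X : Type*} [NormedAddCommGroup X]
    [InnerProductSpace ℝ X] {A : X →L[ℝ] X} {c : ℝ} (h : c • (1 : X →L[ℝ] X) ≤ A)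
    (d : ℝ) : (d + c) • (1 : X →L[ℝ] X) ≤ d • 1 + A := by
  rw [ContinuousLinearMap.le_def, add_smul, add_sub_add_left_eq_sub]
  exact h

end SchurComplement

/-! ### Derivatives of the partial gradients and of the saddle operator. -/

section SaddleOperator

variable {X Y : Type*} [NormedAddCommGroup X] [InnerProductSpace ℝ X] [CompleteSpace X]
  [NormedAddCommGroup Y] [InnerProductSpace ℝ Y] [CompleteSpace Y] {φ : X → Y → ℝ}

lemma inner_gradX {X Y : Type*} [NormedAddCommGroup X] [InnerProductSpace ℝ X]
    [CompleteSpace X] [NormedAddCommGroup Y] [InnerProductSpace ℝ Y] {φ : X → Y → ℝ}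
    (hφ : Differentiable ℝ (fun p : X × Y => φ p.1 p.2)) (p : X × Y) (h : X) :
    ⟪gradX φ p.1 p.2, h⟫ = fderiv ℝ (fun p : X × Y => φ p.1 p.2) p (h, 0) := by
  have h1 : HasFDerivAt (fun x => φ x p.2)
      (fderiv ℝ (fun p : X × Y => φ p.1 p.2) p ∘L .inl ℝ X Y) p.1 :=
    (hφ p).hasFDerivAt.comp p.1 (f := fun x => (x, p.2)) (hasFDerivAt_prodMk_left p.1 p.2)
  rw [gradX, ← InnerProductSpace.toDual_apply_apply (𝕜 := ℝ), toDual_gradient, h1.fderiv]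
  simp

lemma inner_gradY {X Y : Type*} [NormedAddCommGroup X] [InnerProductSpace ℝ X]
    [NormedAddCommGroup Y] [InnerProductSpace ℝ Y] [CompleteSpace Y] {φ : X → Y → ℝ}
    (hφ : Differentiable ℝ (fun p : X × Y => φ p.1 p.2)) (p : X × Y) (k : Y) :
    ⟪gradY φ p.1 p.2, k⟫ = fderiv ℝ (fun p : X × Y => φ p.1 p.2) p (0, k) := by
  have h1 : HasFDerivAt (fun y => φ p.1 y)
      (fderiv ℝ (fun p : X × Y => φ p.1 p.2) p ∘L .inr ℝ X Y) p.2 :=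
    (hφ p).hasFDerivAt.comp p.2 (f := fun y => (p.1, y)) (hasFDerivAt_prodMk_right p.1 p.2)
  rw [gradY, ← InnerProductSpace.toDual_apply_apply (𝕜 := ℝ), toDual_gradient, h1.fderiv]
  simp

/-- The partial gradient is the Riesz representative of the full derivative restricted to `X × 0`,
which costs one order of smoothness. -/
lemma contDiff_gradX (hφ : ContDiff ℝ 2 (fun p : X × Y => φ p.1 p.2)) :
    ContDiff ℝ 1 (fun p : X × Y => gradX φ p.1 p.2) := by
  have h : (fun p : X × Y => gradX φ p.1 p.2) = fun p => (InnerProductSpace.toDual ℝ X).symm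
      (fderiv ℝ (fun p : X × Y => φ p.1 p.2) p ∘L .inl ℝ X Y) := by
    funext p
    refine ext_inner_right ℝ fun v => ?_
    rw [inner_gradX (hφ.differentiable two_ne_zero), InnerProductSpace.toDual_symm_apply]
    simp
  rw [h]
  exact (InnerProductSpace.toDual ℝ X).symm.contDiff.comp
    ((hφ.fderiv_right (m := 1) (by norm_num)).clm_comp contDiff_const)

lemma contDiff_gradY (hφ : ContDiff ℝ 2 (fun p : X × Y => φ p.1 p.2)) :
    ContDiff ℝ 1 (fun p : X × Y => gradY φ p.1 p.2) := by
  have h : (fun p : X × Y => gradY φ p.1 p.2) = fun p => (InnerProductSpace.toDual ℝ Y).symm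
      (fderiv ℝ (fun p : X × Y => φ p.1 p.2) p ∘L .inr ℝ X Y) := by
    funext p
    refine ext_inner_right ℝ fun v => ?_
    rw [inner_gradY (hφ.differentiable two_ne_zero), InnerProductSpace.toDual_symm_apply]
    simp
  rw [h]
  exact (InnerProductSpace.toDual ℝ Y).symm.contDiff.comp
    ((hφ.fderiv_right (m := 1) (by norm_num)).clm_comp contDiff_const)

lemma fderiv_eq_partial_add {X Y Z : Type*} [NormedAddCommGroup X] [NormedSpace ℝ X]
    [NormedAddCommGroup Y] [NormedSpace ℝ Y] [NormedAddCommGroup Z] [NormedSpace ℝ Z] {g : X → Y → Z}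
    {p : X × Y} (hg : DifferentiableAt ℝ (fun p : X × Y => g p.1 p.2) p) (q : X × Y) :
    fderiv ℝ (fun p : X × Y => g p.1 p.2) p q =
      fderiv ℝ (fun x => g x p.2) p.1 q.1 + fderiv ℝ (fun y => g p.1 y) p.2 q.2 := by
  have h1 : HasFDerivAt (fun x => g x p.2)
      (fderiv ℝ (fun p : X × Y => g p.1 p.2) p ∘L .inl ℝ X Y) p.1 :=
    hg.hasFDerivAt.comp p.1 (f := fun x => (x, p.2)) (hasFDerivAt_prodMk_left p.1 p.2)
  have h2 : HasFDerivAt (fun y => g p.1 y)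
      (fderiv ℝ (fun p : X × Y => g p.1 p.2) p ∘L .inr ℝ X Y) p.2 :=
    hg.hasFDerivAt.comp p.2 (f := fun y => (p.1, y)) (hasFDerivAt_prodMk_right p.1 p.2)
  rw [h1.fderiv, h2.fderiv]
  simp [← map_add]

lemma fderiv_gradX (hφ : ContDiff ℝ 2 (fun p : X × Y => φ p.1 p.2)) (p q : X × Y) :
    fderiv ℝ (fun p : X × Y => gradX φ p.1 p.2) p q =
      hessXX φ p.1 p.2 q.1 + hessXY φ p.1 p.2 q.2 :=
  fderiv_eq_partial_add ((contDiff_gradX hφ).differentiable one_ne_zero p) q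

lemma fderiv_gradY (hφ : ContDiff ℝ 2 (fun p : X × Y => φ p.1 p.2)) (p q : X × Y) :
    fderiv ℝ (fun p : X × Y => gradY φ p.1 p.2) p q =
      hessYX φ p.1 p.2 q.1 + hessYY φ p.1 p.2 q.2 :=
  fderiv_eq_partial_add ((contDiff_gradY hφ).differentiable one_ne_zero p) q

/-- The mixed Hessian blocks are adjoint to each other. -/
lemma inner_hessXY (hφ : ContDiff ℝ 2 (fun p : X × Y => φ p.1 p.2)) (x : X) (y : Y)
    (k : Y) (h : X) : ⟪hessXY φ x y k, h⟫ = ⟪k, hessYX φ x y h⟫ := by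
  have hd := hφ.differentiable two_ne_zero
  have hD := (hφ.fderiv_right (m := 1) (by norm_num)).differentiable one_ne_zero (x, y)
  have hX := (contDiff_gradX hφ).differentiable one_ne_zero (x, y)
  have hY := (contDiff_gradY hφ).differentiable one_ne_zero (x, y)
  -- Differentiating `inner_gradX` and `inner_gradY` expresses the mixed blocks through the full
  -- second derivative, whose symmetry concludes.
  have e1 : ⟪hessXY φ x y k, h⟫ =
      fderiv ℝ (fderiv ℝ (fun p : X × Y => φ p.1 p.2)) (x, y) (0, k) (h, 0) := by
    have h1 := hX.hasFDerivAt.inner ℝ (hasFDerivAt_const h (x, y))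
    have h2 := hD.hasFDerivAt.clm_apply (hasFDerivAt_const ((h, 0) : X × Y) (x, y))
    simp only [inner_gradX hd] at h1
    have h3 := congrArg (fun L => L (0, k)) (h1.unique h2)
    simpa [fderiv_gradX hφ] using h3
  have e2 : ⟪hessYX φ x y h, k⟫ =
      fderiv ℝ (fderiv ℝ (fun p : X × Y => φ p.1 p.2)) (x, y) (h, 0) (0, k) := by
    have h1 := hY.hasFDerivAt.inner ℝ (hasFDerivAt_const k (x, y))
    have h2 := hD.hasFDerivAt.clm_apply (hasFDerivAt_const ((0, k) : X × Y) (x, y))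
    simp only [inner_gradY hd] at h1
    have h3 := congrArg (fun L => L (h, 0)) (h1.unique h2)
    simpa [fderiv_gradY hφ] using h3
  rw [e1, real_inner_comm, e2]
  exact hφ.contDiffAt.isSymmSndFDerivAt (by simp) _ _

/-- The saddle operator as a function. -/
noncomputable def saddleMap (φ : X → Y → ℝ) (z : WithLp 2 (X × Y)) : WithLp 2 (X × Y) :=
  WithLp.toLp 2 (gradX φ z.fst z.snd, -gradY φ z.fst z.snd)

lemma hasStrictFDerivAt_saddleMap (hφ : ContDiff ℝ 2 (fun p : X × Y => φ p.1 p.2))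
    (z : WithLp 2 (X × Y)) : ∃ T' : WithLp 2 (X × Y) →L[ℝ] WithLp 2 (X × Y),
      HasStrictFDerivAt (saddleMap φ) T' z ∧ ∀ q, T' q = WithLp.toLp 2
        (hessXX φ z.fst z.snd q.fst + hessXY φ z.fst z.snd q.snd,
          -(hessYX φ z.fst z.snd q.fst + hessYY φ z.fst z.snd q.snd)) := by
  set L := WithLp.prodContinuousLinearEquiv 2 ℝ X Y
  have h1 := ((contDiff_gradX hφ).contDiffAt (x := L z)).hasStrictFDerivAt one_ne_zero
  have h2 := ((contDiff_gradY hφ).contDiffAt (x := L z)).hasStrictFDerivAt one_ne_zero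
  have h3 := (L.symm.hasStrictFDerivAt (x := (gradX φ z.fst z.snd, -gradY φ z.fst z.snd))).comp z
    ((h1.prodMk h2.neg).comp z L.hasStrictFDerivAt)
  refine ⟨_, h3, fun q => ?_⟩
  have e1 := fderiv_gradX hφ (L z) (L q)
  have e2 := fderiv_gradY hφ (L z) (L q)
  simp only [ContinuousLinearMap.comp_apply, ContinuousLinearEquiv.coe_coe,
    ContinuousLinearMap.prod_apply, neg_apply, e1, e2]
  rfl

/-- The regularized operator `id + δ T_φ` has a `(1 + α δ)`-cocoercive inverse. -/
lemma mul_inner_sub_le_saddleMap (hφ : ContDiff ℝ 2 (fun p : X × Y => φ p.1 p.2)) {σ α δ : ℝ}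
    (hσ : IsConvexConcave φ σ) (hδ : 0 < δ) (hδσ : 0 < 1 + δ * σ) (hα : 0 < 1 + α * δ)
    (hdom : IsInteractionDominant φ α δ) (z w : WithLp 2 (X × Y)) :
    (1 + α * δ) * ⟪(z + δ • saddleMap φ z) - (w + δ • saddleMap φ w), z - w⟫ ≤
      ‖(z + δ • saddleMap φ z) - (w + δ • saddleMap φ w)‖ ^ 2 := by
  choose T' hT hT' using hasStrictFDerivAt_saddleMap hφ
  have hc : 0 < 1 / δ + σ := by
    have : 1 / δ + σ = (1 + δ * σ) / δ := by field_simp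
    rw [this]; positivity
  have hγ : 0 < 1 / δ + α := by
    have : 1 / δ + α = (1 + α * δ) / δ := by field_simp
    rw [this]; positivity
  refine mul_inner_sub_le_of_fderiv (F := fun z => z + δ • saddleMap φ z)
    (F' := fun z => ContinuousLinearMap.id ℝ (WithLp 2 (X × Y)) + δ • T' z) hα hδσ
    (fun z => HasStrictFDerivAt.fun_add (hasStrictFDerivAt_id z) ((hT z).const_smul δ)) (fun z q => ?_)
    (fun z q => ?_) z w
  · have hx := inner_ge_of_smul_one_le (hσ z.fst z.snd).1 q.fst
    have hy := inner_ge_of_smul_one_le (hσ z.fst z.snd).2 q.snd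
    have hxy := inner_hessXY hφ z.fst z.snd q.snd q.fst
    -- The mixed blocks cancel, so only the two diagonal bounds remain.
    have hT2 : σ * ‖q‖ ^ 2 ≤ ⟪T' z q, q⟫ := by
      rw [hT', WithLp.prod_inner_apply, WithLp.prod_norm_sq_eq_of_L2]
      change _ ≤ ⟪_, q.fst⟫ + ⟪_, q.snd⟫
      simp only [inner_add_left, inner_neg_left, neg_apply] at hy ⊢
      rw [hxy, real_inner_comm q.snd (hessYX φ z.fst z.snd q.fst)]
      linarith
    simp only [add_apply, smul_apply, ContinuousLinearMap.id_apply, inner_add_left,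
      real_inner_smul_left, real_inner_self_eq_norm_sq]
    nlinarith
  · set P := (1 / δ) • 1 + hessXX φ z.fst z.snd with hP
    set R := (1 / δ) • 1 - hessYY φ z.fst z.snd with hR
    obtain ⟨hd1, hd2⟩ := hdom z.fst z.snd
    obtain ⟨hs1, hs2⟩ := hσ z.fst z.snd
    have hblock := mul_inner_block_le_of_schur_ge (P := P) (R := R)
      (B := hessXY φ z.fst z.snd) (C := hessYX φ z.fst z.snd) hc hγ
      (inner_hessXY hφ z.fst z.snd)
      (inner_symm_of_smul_one_le (c := 1 / δ + σ) (smul_one_add_le_of_smul_one_le hs1 _))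
      (inner_symm_of_smul_one_le (c := 1 / δ + σ) (by
        rw [hR, sub_eq_add_neg]; exact smul_one_add_le_of_smul_one_le hs2 _))
      (inner_ge_of_smul_one_le (smul_one_add_le_of_smul_one_le hs1 _))
      (inner_ge_of_smul_one_le (by
        rw [hR, sub_eq_add_neg]; exact smul_one_add_le_of_smul_one_le hs2 _))
      (fun x => by
        have h := inner_ge_of_smul_one_le hd1 x
        simp only [hP, add_apply, smul_apply, one_apply_eq_self, inner_add_left,
          real_inner_smul_left, real_inner_self_eq_norm_sq,
          ContinuousLinearMap.comp_apply] at h ⊢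
        linarith)
      (fun y => by
        have h := inner_ge_of_smul_one_le hd2 y
        rw [hR]
        simp only [add_apply, sub_apply, neg_apply, smul_apply, one_apply_eq_self,
          inner_add_left, inner_sub_left, inner_neg_left, real_inner_smul_left,
          real_inner_self_eq_norm_sq, ContinuousLinearMap.comp_apply] at h ⊢
        linarith) q.fst q.snd
    -- Factoring out `δ` puts `1 / δ` on the diagonal, matching the inverses in the dominance
    -- condition.
    have hK : (ContinuousLinearMap.id ℝ (WithLp 2 (X × Y)) + δ • T' z) q = δ • WithLp.toLp 2
        (P q.fst + hessXY φ z.fst z.snd q.snd, R q.snd - hessYX φ z.fst z.snd q.fst) := by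
      simp only [add_apply, smul_apply, ContinuousLinearMap.id_apply, hT']
      refine (WithLp.equiv 2 (X × Y)).injective (Prod.ext ?_ ?_)
      · change q.fst + δ • (hessXX φ z.fst z.snd q.fst + hessXY φ z.fst z.snd q.snd) =
          δ • ((1 / δ) • q.fst + hessXX φ z.fst z.snd q.fst + hessXY φ z.fst z.snd q.snd)
        simp only [smul_add, smul_smul, mul_one_div_cancel hδ.ne', one_smul, add_assoc]
      · change q.snd + δ • -(hessYX φ z.fst z.snd q.fst + hessYY φ z.fst z.snd q.snd) =
          δ • ((1 / δ) • q.snd - hessYY φ z.fst z.snd q.snd - hessYX φ z.fst z.snd q.fst)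
        simp only [smul_sub, smul_neg, smul_add, smul_smul, mul_one_div_cancel hδ.ne', one_smul]
        abel
    change _ * ⟪(ContinuousLinearMap.id ℝ (WithLp 2 (X × Y)) + δ • T' z) q, q⟫ ≤
      ‖(ContinuousLinearMap.id ℝ (WithLp 2 (X × Y)) + δ • T' z) q‖ ^ 2
    rw [hK, real_inner_smul_left, norm_smul, mul_pow, WithLp.prod_inner_apply,
      WithLp.prod_norm_sq_eq_of_L2, Real.norm_eq_abs, sq_abs]
    have e : 1 + α * δ = δ * (1 / δ + α) := by field_simp
    rw [e]
    have := mul_le_mul_of_nonneg_left hblock (sq_nonneg δ)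
    refine le_trans (le_of_eq ?_) this
    change _ * (δ * (⟪_, q.fst⟫ + ⟪_, q.snd⟫)) = _
    ring

end SaddleOperator

/-! ### From the cocoercivity estimate to semimonotonicity. -/

lemma isSemimonotone_saddleOp {X Y : Type*}
    [NormedAddCommGroup X] [InnerProductSpace ℝ X] [CompleteSpace X]
    [NormedAddCommGroup Y] [InnerProductSpace ℝ Y] [CompleteSpace Y] {φ : X → Y → ℝ} {μ ρ : ℝ}
    (h : ∀ z w, μ * ‖z - w‖ ^ 2 + ρ * ‖saddleMap φ z - saddleMap φ w‖ ^ 2 ≤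
      ⟪z - w, saddleMap φ z - saddleMap φ w⟫) : IsSemimonotone (saddleOp φ) μ ρ := by
  rintro x' y' rfl
  refine ⟨rfl, ?_⟩
  rintro x y rfl
  exact h x x'

/-- The condition `δ * max 0 (-σ) < 1` says `δ < 1 / max 0 (-σ)`, where `1 / 0 = ∞`. -/
theorem proposition4p12 (n m : ℕ)
    (φ : EuclideanSpace ℝ (Fin n) → EuclideanSpace ℝ (Fin m) → ℝ) (σ α δ : ℝ)
    (hφ : ContDiff ℝ 2
      (fun p : EuclideanSpace ℝ (Fin n) × EuclideanSpace ℝ (Fin m) => φ p.1 p.2))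
    (hσ : IsConvexConcave φ σ)
    (hδ : 0 < δ) (hδσ : δ * max 0 (-σ) < 1)
    (hα : -(1 / δ) < α)
    (hdom : IsInteractionDominant φ α δ) :
    (α < 1 / δ →
      IsSemimonotone (saddleOp φ) (α / (1 - α * δ)) (-(δ / (1 - α * δ)))) ∧
    (0 ≤ α → IsSemimonotone (saddleOp φ) 0 (-δ)) := by
  have hδσ' : 0 < 1 + δ * σ := by nlinarith [le_max_right 0 (-σ)]
  have hα' : 0 < 1 + α * δ := by
    rw [← neg_div, div_lt_iff₀ hδ] at hα
    linarith
  have key := fun z w => mul_inner_sub_le_saddleMap hφ hσ hδ hδσ' hα' hdom z w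
  have hexp : ∀ z w, (z + δ • saddleMap φ z) - (w + δ • saddleMap φ w) =
      (z - w) + δ • (saddleMap φ z - saddleMap φ w) := fun z w => by
    rw [smul_sub]; abel
  simp only [hexp] at key
  refine ⟨fun h => isSemimonotone_saddleOp fun z w => ?_,
    fun h => isSemimonotone_saddleOp fun z w => ?_⟩
  · have hpos : 0 < 1 - α * δ := by
      rw [lt_div_iff₀ hδ] at h
      linarith
    have hk := key z w
    rw [norm_add_sq_real, inner_add_left, real_inner_self_eq_norm_sq, norm_smul, mul_pow,
      Real.norm_eq_abs, sq_abs, real_inner_smul_left, real_inner_smul_right,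
      real_inner_comm (z - w) (saddleMap φ z - saddleMap φ w)] at hk
    set U := ‖z - w‖ ^ 2
    set V := ‖saddleMap φ z - saddleMap φ w‖ ^ 2
    set I := ⟪z - w, saddleMap φ z - saddleMap φ w⟫
    -- This is the expanded estimate divided by `δ`.
    have h1 : α * U - δ * V ≤ (1 - α * δ) * I := by
      refine le_of_mul_le_mul_left ?_ hδ
      linarith
    have h2 : α / (1 - α * δ) * U + -(δ / (1 - α * δ)) * V = (α * U - δ * V) / (1 - α * δ) := by
      ring
    rw [h2, div_le_iff₀ hpos, mul_comm I]
    exact h1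
  · have hk := key z w
    -- For `α ≥ 0` the factor `1 + αδ` can be lowered to `1`: directly if the pairing is
    -- nonnegative, trivially otherwise. No upper bound on `α` is then needed.
    have hle : ⟪z - w + δ • (saddleMap φ z - saddleMap φ w), z - w⟫ ≤
        ‖z - w + δ • (saddleMap φ z - saddleMap φ w)‖ ^ 2 := by
      rcases le_total 0 ⟪z - w + δ • (saddleMap φ z - saddleMap φ w), z - w⟫ with h0 | h0
      · nlinarith [mul_nonneg (mul_nonneg h hδ.le) h0]
      · exact h0.trans (sq_nonneg _)
    rw [norm_add_sq_real, inner_add_left, real_inner_self_eq_norm_sq, norm_smul, mul_pow,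
      Real.norm_eq_abs, sq_abs, real_inner_smul_left, real_inner_smul_right,
      real_inner_comm (z - w) (saddleMap φ z - saddleMap φ w)] at hle
    refine le_of_mul_le_mul_left ?_ hδ
    linarith
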